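/- Consider a single server and $k\ge 2$ queues. A job instance $I$ is a finite family of jobs; job $j$ arrives at queue $\xi_j\in\{1,\dots,k\}$ at time $r_j\ge 0$ with workload $p_j$, where $0\le p_{\min}\le p_j\le p_{\max}$ for bounds with $p_{\max}\le\gamma p_{\min}$, for a constant $\gamma\ge 1$. Jobs are processed non-preemptively, one at a time, and not before they arrive. A setup time $\tau>0$ is needed whenever the server switches to another queue, and no queue is set up at time $0$. The cost of a schedule is its total completion time $\sum_j C_j$; $C^*(I)$ is the optimal cost of the offline problem, in which $I$ is known in advance, and $C^{e}(I)$ is the cost of the schedule that a policy $e$ gives for $I$. Let $\Pi_2$ be the class of cyclic exhaustive policies without skipping empty queues: starting with a setup of queue $1$ at time $0$, the server visits the queues in the cyclic order $1,\dots,k,1,\dots,k,\dots$; at the end of each visit it immediately sets up the next queue, whether it is empty or not; when it ends a visit, no unserved job is present in that queue; and the server spends at most $m\,p_{\max}$ time in a visit (setup not included) in which it serves $m$ jobs, where the same bound holds for the part of the visit up to the completion of its $m'$-th job, $1\le m'\le m$, with $m'$ in place of $m$. Within these limits the server may wait in a queue, and the order of service within a visit is arbitrary. Then every $e\in\Pi_2$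 has competitive ratio $\kappa=\max\{\tfrac32\gamma,\,k+1\}$, that is, $C^{e}(I)\le\kappa\,C^*(I)$ for every such instance $I$. Moreover, if $\tfrac32\gamma\le k+1$, then for every $e\in\Pi_2$ and every $\epsilon>0$ there is such an instance $I$, with positive workloads whose minimum and maximum are $p_{\min}$ and $p_{\max}$, such that $\frac{C^{e}(I)}{C^*(I)}>\kappa-\epsilon$. -/

import Mathlib

open Finset

namespace Polling

noncomputable section

/-- A job instance for a polling system with `k` queues: job `j` arrives in queue `queue j` at time
`release j` with workload `work j`. The numbers `pmin` and `pmax` are the bounds on the workloads;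
they need not be attained. -/
structure Instance (k : ℕ) where
  n : ℕ
  queue : Fin n → Fin k
  release : Fin n → ℝ
  work : Fin n → ℝ
  pmin : ℝ
  pmax : ℝ
  release_nonneg : ∀ j, 0 ≤ release j
  pmin_nonneg : 0 ≤ pmin
  pmin_le_pmax : pmin ≤ pmax
  pmin_le_work : ∀ j, pmin ≤ work j
  work_le_pmax : ∀ j, work j ≤ pmax

variable {k : ℕ}

/-- The workload variation is bounded by `γ`. -/
def Instance.BoundedVariation (γ : ℝ) (I : Instance k) : Prop :=
  I.pmax ≤ γ * I.pmin

/-- The bounds `pmin` and `pmax` are the minimum and the maximum of the workloads. -/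
def Instance.BoundsAttained (I : Instance k) : Prop :=
  (∃ j, I.work j = I.pmin) ∧ (∃ j, I.work j = I.pmax)

/-- A (non-preemptive) schedule, given by the times at which the jobs are started. -/
abbrev Schedule (I : Instance k) : Type := Fin I.n → ℝ

/-- Job `j` is completed at time `s j + I.work j`. -/
def totalCompletion (I : Instance k) (s : Schedule I) : ℝ :=
  ∑ j, (s j + I.work j)

/-- Schedules of a single server with setup time `τ`: no job is started before it arrives, no queue
is set up at time `0`, jobs are processed one at a time, and a setup takes place between jobs of
different queues. The server may idle, and the start times may depend on the whole instance. -/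
structure IsFeasible (τ : ℝ) (I : Instance k) (s : Schedule I) : Prop where
  release_le : ∀ j, I.release j ≤ s j
  setup_le : ∀ j, τ ≤ s j
  separated : ∀ i j, i ≠ j →
    s i + I.work i + (if I.queue i = I.queue j then 0 else τ) ≤ s j ∨
    s j + I.work j + (if I.queue i = I.queue j then 0 else τ) ≤ s i

/-- The optimal total completion time of the offline problem. -/
def optCompletion (τ : ℝ) (I : Instance k) : ℝ :=
  sInf {c | ∃ s : Schedule I, IsFeasible τ I s ∧ totalCompletion I s = c}

/-- The schedule `s` comes from a cyclic exhaustive service of the queues, without skipping empty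
queues. The visits of the server to the queues are numbered `0, 1, 2, …`; visit `v` is to queue
`v % k`, it begins (after the setup) at time `a v` and ends at time `d v`; job `j` is served during
visit `visit j`. -/
structure IsCyclicExhaustiveWith (τ : ℝ) (I : Instance k) (s : Schedule I)
    (a d : ℕ → ℝ) (visit : Fin I.n → ℕ) : Prop where
  /-- The server starts at time `0` by setting up the first queue. -/
  first : a 0 = τ
  /-- At the end of a visit the server sets up the next queue, empty or not. -/
  next : ∀ v, a (v + 1) = d v + τ
  begin_le_end : ∀ v, a v ≤ d v
  queue_eq : ∀ j, (I.queue j : ℕ) = visit j % k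
  release_le : ∀ j, I.release j ≤ s j
  /-- A job is processed within its visit. -/
  begin_le : ∀ j, a (visit j) ≤ s j
  le_end : ∀ j, s j + I.work j ≤ d (visit j)
  /-- Jobs of the same visit are processed one at a time. -/
  disjoint : ∀ i j, i ≠ j → visit i = visit j →
    s i + I.work i ≤ s j ∨ s j + I.work j ≤ s i
  /-- Exhaustive service: no job is present in the queue when the server switches out. -/
  exhaustive : ∀ v j, (I.queue j : ℕ) = v % k → I.release j ≤ d v → visit j ≤ v
  /-- A visit during which `m` jobs are served lasts for at most `m * pmax`. -/
  length_le : ∀ v, d v ≤ a v + (#{i | visit i = v} : ℝ) * I.pmax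
  /-- The same for the part of a visit up to the completion of its `m`-th job. Waiting within these
  limits is allowed, and the order of service is arbitrary. -/
  completion_le : ∀ j, s j + I.work j ≤
    a (visit j) + (#{i | visit i = visit j ∧ s i ≤ s j} : ℝ) * I.pmax

def IsCyclicExhaustive (τ : ℝ) (I : Instance k) (s : Schedule I) : Prop :=
  ∃ (a d : ℕ → ℝ) (visit : Fin I.n → ℕ), IsCyclicExhaustiveWith τ I s a d visit

/-- A deterministic policy gives a schedule for every instance. (Nothing forces it to be
non-anticipative, so online policies are included.) -/
abbrev Policy (k : ℕ) : Type := ∀ I : Instance k, Schedule I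

/-- The cyclic exhaustive policies without skipping empty queues, for the system with `k` queues,
setup time `τ` and workload variation bounded by `γ`. -/
def Pi2 (k : ℕ) (τ γ : ℝ) : Set (Policy k) :=
  {e | ∀ I : Instance k, I.BoundedVariation γ → IsCyclicExhaustive τ I (e I)}

/-- The competitive ratio of `e` is `ρ`, as an upper bound. -/
def HasCompetitiveRatio (τ γ : ℝ) (e : Policy k) (ρ : ℝ) : Prop :=
  ∀ I : Instance k, I.BoundedVariation γ →
    totalCompletion I (e I) ≤ ρ * optCompletion τ I

end

end Polling

namespace Polling

variable {k : ℕ}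

/-! Upper bound: under a cyclic exhaustive policy a job waits for at most one cycle of `k` setups
after its release, plus at most `pmax` for each job served up to and including itself. Positions in
the service order sum to at most `n(n+1)/2`, so the cost is at most `∑ r + nkτ + γ pmin n(n+1)/2`
(`totalCompletion_le`). The optimum is at least `A = ∑ r + n pmin` and at least `B = nτ + pmin
n(n+1)/2`. Since `k` and `γ` are both at most `κ - 1`, the cost is at most `A + (κ - 1) B`, hence at
most `κ` times the optimum.

Lower bound: a tiny job reaches the first queue just after the server must have left it, and waits
for a full cycle: about `(k + 1)τ` against `τ`. -/

lemma Instance.work_nonneg (I : Instance k) (j : Fin I.n) : 0 ≤ I.work j :=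
  I.pmin_nonneg.trans (I.pmin_le_work j)

lemma Instance.pmax_nonneg (I : Instance k) : 0 ≤ I.pmax :=
  I.pmin_nonneg.trans I.pmin_le_pmax

/-! ### Lower bounds for the offline optimum -/

section Feasible

variable {τ : ℝ} {I : Instance k} {s : Schedule I}

lemma IsFeasible.sum_release_le (h : IsFeasible τ I s) :
    ∑ j, I.release j + I.n * I.pmin ≤ totalCompletion I s := by
  have h1 : ∑ j : Fin I.n, (I.release j + I.pmin) ≤ totalCompletion I s :=
    sum_le_sum fun j _ => add_le_add (h.release_le j) (I.pmin_le_work j)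
  simpa [sum_add_distrib] using h1

/-- In a feasible schedule two jobs of which one starts no later than the other start at least
`pmin` apart. -/
lemma IsFeasible.start_add_pmin_le (h : IsFeasible τ I s) (hτ : 0 ≤ τ) {i j : Fin I.n}
    (hij : i ≠ j) (hs : s i ≤ s j) : s i + I.pmin ≤ s j := by
  have hi := I.pmin_le_work i
  have hj := I.pmin_le_work j
  have hp := I.pmin_nonneg
  have h0 : (0 : ℝ) ≤ if I.queue i = I.queue j then 0 else τ := by split_ifs <;> simp [hτ]
  rcases h.separated i j hij with h1 | h1 <;> linarith

/-- Sorting by start time turns the pairwise gaps `pmin` into a bound for each rank, counted from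
zero. -/
lemma IsFeasible.le_start_sort (h : IsFeasible τ I s) (hτ : 0 ≤ τ) (i : ℕ) (hi : i < I.n) :
    τ + i * I.pmin ≤ s (Tuple.sort s ⟨i, hi⟩) := by
  induction i with
  | zero => simpa using h.setup_le _
  | succ i ih =>
    have hi' : i < I.n := by omega
    have hmono : s (Tuple.sort s ⟨i, hi'⟩) ≤ s (Tuple.sort s ⟨i + 1, hi⟩) :=
      Tuple.monotone_sort s (show (⟨i, hi'⟩ : Fin I.n) ≤ ⟨i + 1, hi⟩ by simp)
    have hne : Tuple.sort s ⟨i, hi'⟩ ≠ Tuple.sort s ⟨i + 1, hi⟩ := by simp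
    have h1 := h.start_add_pmin_le hτ hne hmono
    have h2 := ih hi'
    push_cast
    linarith

lemma IsFeasible.setup_add_work_le (h : IsFeasible τ I s) (hτ : 0 ≤ τ) :
    I.n * τ + I.pmin * (I.n * (I.n + 1) / 2) ≤ totalCompletion I s := by
  have h1 : ∑ i : Fin I.n, (τ + (i : ℕ) * I.pmin + I.pmin) ≤ totalCompletion I s := by
    rw [totalCompletion, ← Equiv.sum_comp (Tuple.sort s) fun j => s j + I.work j]
    exact sum_le_sum fun i _ => add_le_add (h.le_start_sort hτ i i.2) (I.pmin_le_work _)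
  have h2 : ∀ n : ℕ, ∑ i : Fin n, (τ + (i : ℕ) * I.pmin + I.pmin) =
      n * τ + I.pmin * (n * (n + 1) / 2) := by
    intro n
    induction n with
    | zero => simp
    | succ n ih => rw [Fin.sum_univ_castSucc]; simp [ih]; ring
  rwa [h2] at h1

lemma optCompletion_le (h : IsFeasible τ I s) : optCompletion τ I ≤ totalCompletion I s := by
  refine csInf_le ⟨∑ j, I.release j + I.n * I.pmin, ?_⟩ ⟨s, h, rfl⟩
  rintro _ ⟨t, ht, rfl⟩
  exact ht.sum_release_le

/-- The schedule `s` only shows that the infimum is over a nonempty set; the policy's own schedule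
will serve. -/
lemma le_optCompletion (h : IsFeasible τ I s) {c : ℝ}
    (hc : ∀ t, IsFeasible τ I t → c ≤ totalCompletion I t) : c ≤ optCompletion τ I := by
  refine le_csInf ⟨_, s, h, rfl⟩ ?_
  rintro _ ⟨t, ht, rfl⟩
  exact hc t ht

end Feasible

/-! ### Cost of cyclic exhaustive schedules -/

namespace IsCyclicExhaustiveWith

variable {τ : ℝ} {I : Instance k} {s : Schedule I} {a d : ℕ → ℝ} {visit : Fin I.n → ℕ}

lemma begin_add_le (h : IsCyclicExhaustiveWith τ I s a d visit) (v m : ℕ) :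
    a v + m * τ ≤ a (v + m) := by
  induction m with
  | zero => simp
  | succ m ih =>
    have h1 := h.next (v + m)
    have h2 := h.begin_le_end (v + m)
    rw [← add_assoc, h1]
    push_cast
    linarith

lemma end_add_le_begin (h : IsCyclicExhaustiveWith τ I s a d visit) (hτ : 0 ≤ τ) {u v : ℕ}
    (huv : u < v) : d u + τ ≤ a v := by
  obtain ⟨m, rfl⟩ := Nat.exists_eq_add_of_lt huv
  have h1 := h.begin_add_le (u + 1) m
  rw [h.next, show u + 1 + m = u + m + 1 by omega] at h1
  have : 0 ≤ m * τ := by positivity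
  linarith

/-- A cyclic exhaustive schedule is feasible. -/
lemma isFeasible (h : IsCyclicExhaustiveWith τ I s a d visit) (hτ : 0 ≤ τ) :
    IsFeasible τ I s := by
  refine ⟨h.release_le, fun j => ?_, fun i j hij => ?_⟩
  · have h1 := h.begin_add_le 0 (visit j)
    rw [h.first, zero_add] at h1
    have h2 := h.begin_le j
    have : 0 ≤ visit j * τ := by positivity
    linarith
  · have hle : (if I.queue i = I.queue j then 0 else τ) ≤ τ := by split_ifs <;> simp [hτ]
    have hi := h.begin_le i
    have hj := h.begin_le j
    have hi' := h.le_end i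
    have hj' := h.le_end j
    rcases lt_trichotomy (visit i) (visit j) with hv | hv | hv
    · left
      linarith [h.end_add_le_begin hτ hv]
    · have hq : I.queue i = I.queue j :=
        Fin.ext (by rw [h.queue_eq, h.queue_eq, hv])
      simpa [hq] using h.disjoint i j hij hv
    · right
      linarith [h.end_add_le_begin hτ hv]

/-- During `m` consecutive visits and the setups before them, the server spends time at most
`m * τ` on setups and `pmax` per served job in the visits. -/
lemma begin_add_le_end_add (h : IsCyclicExhaustiveWith τ I s a d visit) (v m : ℕ) :
    a (v + m + 1) ≤
      d v + (m + 1) * τ + (#{i | v < visit i ∧ visit i < v + m + 1} : ℝ) * I.pmax := by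
  induction m with
  | zero =>
    have hp := I.pmax_nonneg
    rw [add_zero, h.next]
    push_cast
    nlinarith [mul_nonneg (Nat.cast_nonneg (α := ℝ)
      (#{i | v < visit i ∧ visit i < v + 1})) hp]
  | succ m ih =>
    have h1 := h.next (v + m + 1)
    have h2 := h.length_le (v + m + 1)
    have hcard : #{i | v < visit i ∧ visit i < v + (m + 1) + 1} =
        #{i | v < visit i ∧ visit i < v + m + 1} + #{i | visit i = v + m + 1} := by
      rw [← card_union_of_disjoint]
      · congr 1
        ext i
        simp only [mem_filter, mem_univ, true_and, mem_union]
        omega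
      · rw [disjoint_filter]
        intro i _
        omega
    rw [hcard, show v + (m + 1) + 1 = v + m + 1 + 1 by omega, h1]
    push_cast
    linarith

lemma begin_le_first (h : IsCyclicExhaustiveWith τ I s a d visit) (v : ℕ) :
    a v ≤ (v + 1) * τ + (#{i | visit i < v} : ℝ) * I.pmax := by
  induction v with
  | zero => simp [h.first]
  | succ v ih =>
    have h2 := h.length_le v
    have hcard : #{i | visit i < v + 1} = #{i | visit i < v} + #{i | visit i = v} := by
      rw [← card_union_of_disjoint]
      · congr 1
        ext i
        simp only [mem_filter, mem_univ, true_and, mem_union]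
        omega
      · rw [disjoint_filter]
        intro i _
        omega
    rw [hcard, h.next]
    push_cast
    linarith

/-- A job that arrives after the end of a visit to its queue is served `k` visits later. -/
lemma begin_visit_le (h : IsCyclicExhaustiveWith τ I s a d visit) (hk : 0 < k) (hτ : 0 ≤ τ)
    (j : Fin I.n) :
    a (visit j) ≤ I.release j + k * τ + (#{i | visit i < visit j} : ℝ) * I.pmax := by
  have hp := I.pmax_nonneg
  rcases lt_or_ge (visit j) k with hv | hv
  -- In the first cycle at most `k` setups precede the visit, counted from time `0`.
  · have h1 := h.begin_le_first (visit j)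
    have h2 : ((visit j : ℝ) + 1) * τ ≤ k * τ :=
      mul_le_mul_of_nonneg_right (by exact_mod_cast hv) hτ
    linarith [I.release_nonneg j]
  · obtain ⟨v, hv'⟩ := Nat.exists_eq_add_of_le' hv
    -- Visit `v` is the previous one to the same queue; had the job been there by its end,
    -- exhaustiveness would have had it served by then.
    have hr : d v < I.release j := by
      by_contra! hle
      have := h.exhaustive v j (by rw [h.queue_eq, hv', Nat.add_mod_right]) hle
      omega
    have h1 := h.begin_add_le_end_add v (k - 1)
    rw [show v + (k - 1) + 1 = visit j by omega, Nat.cast_sub hk, Nat.cast_one,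
      sub_add_cancel] at h1
    have h2 : (#{i | v < visit i ∧ visit i < visit j} : ℝ) ≤ #{i | visit i < visit j} := by
      
      exact_mod_cast card_le_card fun i => by
        simp only [mem_filter, mem_univ, true_and]
        exact And.right
    linarith [mul_le_mul_of_nonneg_right h2 hp]

/-- The cardinality is the position of `j` in the service order: earlier visits first, then start
times within the visit. -/
lemma completion_le_of_release (h : IsCyclicExhaustiveWith τ I s a d visit) (hk : 0 < k)
    (hτ : 0 ≤ τ) (j : Fin I.n) :
    s j + I.work j ≤ I.release j + k * τ +
      (#{i | visit i < visit j ∨ visit i = visit j ∧ s i ≤ s j} : ℝ) * I.pmax := by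
  have hcard : #{i | visit i < visit j ∨ visit i = visit j ∧ s i ≤ s j} =
      #{i | visit i < visit j} + #{i | visit i = visit j ∧ s i ≤ s j} := by
    rw [filter_or, card_union_of_disjoint]
    rw [disjoint_filter]
    intro i _ h1 h2
    omega
  rw [hcard]
  push_cast
  linarith [h.begin_visit_le hk hτ j, h.completion_le j]

/-- The positions of the jobs in the order of service add up to at most `1 + ⋯ + n`. -/
lemma sum_card_le (h : IsCyclicExhaustiveWith τ I s a d visit) (hp : 0 < I.pmin) :
    ∑ j, (#{i | visit i < visit j ∨ visit i = visit j ∧ s i ≤ s j} : ℝ) ≤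
      I.n * (I.n + 1) / 2 := by
  set f : Fin I.n → Fin I.n → ℝ := fun i j =>
    if visit i < visit j ∨ visit i = visit j ∧ s i ≤ s j then 1 else 0 with hf
  have h1 : ∑ j, (#{i | visit i < visit j ∨ visit i = visit j ∧ s i ≤ s j} : ℝ) =
      ∑ j, ∑ i, f i j := sum_congr rfl fun j _ => by simp [hf]
  -- Of two distinct jobs only one precedes the other; as `pmin > 0`, start times within a visit
  -- cannot tie.
  have h2 : ∀ i j, f i j + f j i ≤ 1 + if i = j then 1 else 0 := by
    intro i j
    by_cases hij : i = j
    · subst hij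
      simp [hf]
    · simp only [hij, if_false, hf]
      by_cases hv : visit i = visit j
      · have hi := I.pmin_le_work i
        have hj := I.pmin_le_work j
        rcases h.disjoint i j hij hv with h3 | h3
        · simp [hv, show ¬ s j ≤ s i by linarith]
          split_ifs <;> norm_num
        · simp [hv, show ¬ s i ≤ s j by linarith]
          split_ifs <;> norm_num
      · rcases Nat.lt_or_gt_of_ne hv with h3 | h3
        · simp [h3, h3.not_gt, h3.ne']
        · simp [h3, h3.not_gt, h3.ne']
  have h3 : ∑ j, ∑ i, (f i j + f j i) ≤
      ∑ j : Fin I.n, ∑ i : Fin I.n, ((1 : ℝ) + if i = j then 1 else 0) :=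
    sum_le_sum fun j _ => sum_le_sum fun i _ => h2 i j
  simp only [sum_add_distrib] at h3
  rw [sum_comm (f := fun j i => f j i)] at h3
  simp at h3
  rw [h1]
  linarith

lemma totalCompletion_le (h : IsCyclicExhaustiveWith τ I s a d visit) (hk : 0 < k)
    (hτ : 0 ≤ τ) {γ : ℝ} (hI : I.BoundedVariation γ) :
    totalCompletion I s ≤ ∑ j, I.release j + I.n * (k * τ) +
      γ * I.pmin * (I.n * (I.n + 1) / 2) := by
  have hI' : I.pmax ≤ γ * I.pmin := hI
  have h1 : totalCompletion I s ≤ ∑ j, (I.release j + k * τ +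
      (#{i | visit i < visit j ∨ visit i = visit j ∧ s i ≤ s j} : ℝ) * I.pmax) :=
    sum_le_sum fun j _ => h.completion_le_of_release hk hτ j
  rw [sum_add_distrib, sum_add_distrib, sum_const, card_fin, nsmul_eq_mul] at h1
  have h2 : (∑ j, (#{i | visit i < visit j ∨ visit i = visit j ∧ s i ≤ s j} : ℝ)) * I.pmax ≤
      γ * I.pmin * (I.n * (I.n + 1) / 2) := by
    -- If `pmin = 0`, ties are possible, but then bounded variation forces `pmax = 0` and both sides
    -- vanish.
    rcases I.pmin_nonneg.eq_or_lt with hp | hp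
    · have h0 : I.pmax = 0 := le_antisymm (by simpa [← hp] using hI') I.pmax_nonneg
      simp [h0, ← hp]
    · rw [mul_comm]
      exact mul_le_mul hI' (h.sum_card_le hp) (by positivity) (I.pmax_nonneg.trans hI')
  rw [sum_mul] at h2
  linarith

end IsCyclicExhaustiveWith

theorem hasCompetitiveRatio_of_mem_Pi2 (hk : 2 ≤ k) {τ γ : ℝ} (hτ : 0 < τ) {e : Policy k}
    (he : e ∈ Pi2 k τ γ) :
    HasCompetitiveRatio τ γ e (max (3 / 2 * γ) ((k : ℝ) + 1)) := by
  intro I hI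
  obtain ⟨a, d, visit, h⟩ := he I hI
  have h0 := h.isFeasible hτ.le
  have h1 := h.totalCompletion_le (by omega) hτ.le hI
  have h2 := le_optCompletion h0 fun t ht => ht.sum_release_le
  have h3 := le_optCompletion h0 fun t ht => ht.setup_add_work_le hτ.le
  set κ := max (3 / 2 * γ) ((k : ℝ) + 1)
  have hκ1 : 3 / 2 * γ ≤ κ := le_max_left _ _
  have hκ2 : (k : ℝ) + 1 ≤ κ := le_max_right _ _
  have hk' : (2 : ℝ) ≤ k := by exact_mod_cast hk
  -- For `γ ≤ 2` use `κ - 1 ≥ k ≥ 2`; for `γ ≥ 2` use `3/2 γ - 1 ≥ γ`.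
  have hγκ : γ ≤ κ - 1 := by
    rcases le_total γ 2 with h | h <;> linarith
  have hn : (0 : ℝ) ≤ I.n := Nat.cast_nonneg _
  have hp := I.pmin_nonneg
  have h4 : (I.n : ℝ) * (k * τ) ≤ (κ - 1) * (I.n * τ) := by
    have := mul_le_mul_of_nonneg_right (show (k : ℝ) ≤ κ - 1 by linarith)
      (mul_nonneg hn hτ.le)
    linarith
  have h5 : γ * I.pmin * (I.n * (I.n + 1) / 2) ≤
      (κ - 1) * (I.pmin * (I.n * (I.n + 1) / 2)) := by
    rw [mul_assoc]
    exact mul_le_mul_of_nonneg_right hγκ (by positivity)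
  have h6 := mul_le_mul_of_nonneg_left h3 (show (0 : ℝ) ≤ κ - 1 by linarith)
  have h7 : 0 ≤ I.n * I.pmin := mul_nonneg hn hp
  linarith

/-! ### Tightness: a single late job -/

/-- The instance with a single job, of workload `p`, that arrives in queue `q` at time `r`. -/
def singleJob (q : Fin k) (r p : ℝ) (hr : 0 ≤ r) (hp : 0 ≤ p) : Instance k where
  n := 1
  queue _ := q
  release _ := r
  work _ := p
  pmin := p
  pmax := p
  release_nonneg _ := hr
  pmin_nonneg := hp
  pmin_le_pmax := le_rfl
  pmin_le_work _ := le_rfl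
  work_le_pmax _ := le_rfl

lemma isFeasible_singleJob {τ : ℝ} (q : Fin k) {r p : ℝ} (hr : 0 ≤ r) (hp : 0 ≤ p)
    (hτ : τ ≤ r) : IsFeasible τ (singleJob q r p hr hp) (fun _ => r) where
  release_le _ := le_rfl
  setup_le _ := hτ
  separated i j hij := absurd (Subsingleton.elim (α := Fin 1) i j) hij

lemma totalCompletion_singleJob (q : Fin k) {r p : ℝ} (hr : 0 ≤ r) (hp : 0 ≤ p)
    (s : Schedule (singleJob q r p hr hp)) :
    totalCompletion (singleJob q r p hr hp) s = s (0 : Fin 1) + p :=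
  Fin.sum_univ_one _

/-- A single job that arrives in the first queue after the end of its first visit has to wait for a
whole cycle. -/
lemma IsCyclicExhaustive.le_start_singleJob {τ : ℝ} (hk : 0 < k) (hτ : 0 < τ) {r p : ℝ}
    (hr : 0 ≤ r) (hp : 0 ≤ p) (hτr : τ < r) {s : Schedule (singleJob ⟨0, hk⟩ r p hr hp)}
    (h : IsCyclicExhaustive τ (singleJob ⟨0, hk⟩ r p hr hp) s) :
    (k + 1) * τ ≤ s (0 : Fin 1) := by
  obtain ⟨a, d, visit, h⟩ := h
  have hdvd : k ∣ visit (0 : Fin 1) := Nat.dvd_of_mod_eq_zero (h.queue_eq (0 : Fin 1)).symm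
  -- Visit `0` begins at `τ` and lasts at most `p` even if it serves the job, too short for a job
  -- released after `τ`. The next visit to this queue has index `k`.
  have hpos : 0 < visit (0 : Fin 1) := by
    refine Nat.pos_of_ne_zero fun h0 => ?_
    have h1 := h.le_end (0 : Fin 1)
    have h2 := h.release_le (0 : Fin 1)
    have h3 := h.length_le 0
    rw [h0] at h1
    have hcard : (#{i | visit i = 0} : ℝ) ≤ 1 := by
      exact_mod_cast (card_le_univ _).trans (Fintype.card_fin 1).le
    have h4 := mul_le_mul_of_nonneg_right hcard hp
    change s (0 : Fin 1) + p ≤ d 0 at h1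
    change r ≤ s (0 : Fin 1) at h2
    change d 0 ≤ a 0 + _ * p at h3
    rw [h.first] at h3
    linarith
  have h1 : (k : ℝ) ≤ visit (0 : Fin 1) := by exact_mod_cast Nat.le_of_dvd hpos hdvd
  have h2 := h.begin_add_le 0 (visit (0 : Fin 1))
  rw [h.first, zero_add] at h2
  have h3 := h.begin_le (0 : Fin 1)
  have h4 := mul_le_mul_of_nonneg_right h1 hτ.le
  linarith

theorem exists_lt_ratio_of_mem_Pi2 (hk : 0 < k) {τ γ : ℝ} (hτ : 0 < τ) (hγ : 1 ≤ γ)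
    {e : Policy k} (he : e ∈ Pi2 k τ γ) {ε : ℝ} (hε : 0 < ε) :
    ∃ I : Instance k, I.BoundedVariation γ ∧ I.BoundsAttained ∧ 0 < I.pmin ∧
      0 < optCompletion τ I ∧
      (k : ℝ) + 1 - ε < totalCompletion I (e I) / optCompletion τ I := by
  have hk0 : (0 : ℝ) < k + 1 := by positivity
  -- The optimum lies in `[τ, τ + 2δ]`, so this makes `(k + 1 - ε)` times it less than `(k + 1)τ`.
  obtain ⟨δ, hδ, hδε⟩ : ∃ δ : ℝ, 0 < δ ∧ (k + 1) * (2 * δ) < ε * τ := by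
    refine ⟨ε * τ / (4 * (k + 1)), by positivity, ?_⟩
    have : ((k : ℝ) + 1) * (2 * (ε * τ / (4 * (k + 1)))) = ε * τ / 2 := by
      field_simp
      norm_num
    rw [this]
    exact half_lt_self (by positivity)
  have hr : 0 ≤ τ + δ := by positivity
  set I : Instance k := singleJob ⟨0, hk⟩ (τ + δ) δ hr hδ.le
  have hvar : I.BoundedVariation γ := by
    change δ ≤ γ * δ
    nlinarith
  have hfeas : IsFeasible τ I fun _ => τ + δ :=
    isFeasible_singleJob _ hr hδ.le (by linarith)
  have hopt : optCompletion τ I ≤ τ + 2 * δ := by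
    have h1 := optCompletion_le hfeas
    have h2 := totalCompletion_singleJob ⟨0, hk⟩ hr hδ.le fun _ => τ + δ
    linarith
  have hopt' : τ ≤ optCompletion τ I := by
    refine le_optCompletion hfeas fun t ht => ?_
    have h1 := totalCompletion_singleJob ⟨0, hk⟩ hr hδ.le t
    have h2 := ht.setup_le (0 : Fin 1)
    rw [h1]
    linarith
  have hpos : 0 < optCompletion τ I := hτ.trans_le hopt'
  refine ⟨I, hvar, ⟨⟨(0 : Fin 1), rfl⟩, ⟨(0 : Fin 1), rfl⟩⟩, hδ, hpos, ?_⟩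
  have hcost : (k + 1) * τ ≤ totalCompletion I (e I) := by
    have h1 := totalCompletion_singleJob ⟨0, hk⟩ hr hδ.le (e I)
    have h2 := (he I hvar).le_start_singleJob hk hτ hr hδ.le (by linarith)
    linarith
  rw [lt_div_iff₀ hpos]
  refine lt_of_lt_of_le ?_ hcost
  have h1 := mul_le_mul_of_nonneg_left hopt hk0.le
  have h2 := mul_le_mul_of_nonneg_left hopt' hε.le
  linarith

end Polling

theorem theorem2 (k : ℕ) (hk : 2 ≤ k) (τ γ : ℝ) (hτ : 0 < τ) (hγ : 1 ≤ γ)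
    (e : Polling.Policy k) (he : e ∈ Polling.Pi2 k τ γ) :
    Polling.HasCompetitiveRatio τ γ e (max (3 / 2 * γ) ((k : ℝ) + 1)) ∧
    (3 / 2 * γ ≤ (k : ℝ) + 1 → ∀ ε : ℝ, 0 < ε →
      ∃ I : Polling.Instance k, I.BoundedVariation γ ∧ I.BoundsAttained ∧ 0 < I.pmin ∧
        0 < Polling.optCompletion τ I ∧
        max (3 / 2 * γ) ((k : ℝ) + 1) - ε <
          Polling.totalCompletion I (e I) / Polling.optCompletion τ I) := by
  refine ⟨Polling.hasCompetitiveRatio_of_mem_Pi2 hk hτ he, fun hle ε hε => ?_⟩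
  rw [max_eq_right hle]
  exact Polling.exists_lt_ratio_of_mem_Pi2 (by omega) hτ hγ he hε
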